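/- Let $\bar A\in\{0,\star\}^{n\times n}$ be symmetrically structured, i.e. $\bar A_{ij}=\star$ if and only if $\bar A_{ji}=\star$ and the entries $(i,j)$ and $(j,i)$ share one free real parameter, and let $\bar B\in\{0,\star\}^{n\times m}$ be structured, i.e. each $\star$-entry is an independent free real parameter. Let $N$ be the total number of independent parameters; for $\mathbf p\in\mathbb R^{N}$ let $(\tilde A,\tilde B)$ be the real matrices obtained by assigning the values $\mathbf p$ to the parameters. Suppose that $(\bar A,\bar B)$ is irreducible, i.e. there are no integer $p$ with $0\le p<n$ and no permutation matrix $P$ such that $$P\bar AP^{\top}=\begin{bmatrix}\bar A_{11}&\mathbf 0\\ \mathbf 0&\bar A_{22}\end{bmatrix},\qquad P\bar B=\begin{bmatrix}\bar B_1\\ \mathbf 0\end{bmatrix}$$ with $\bar A_{11}\in\{0,\star\}^{p\times p}$ and $\bar B_1\in\{0,\star\}^{p\times m}$. Then the generic dimension of the controllable subspace of $(\bar A,\bar B)$ equals the term rank of the concatenation $[\bar A,\bar B]$. Here the generic dimension of the controllable subspace is the unique integer $k$ for which there is a proper variety $V\subsetneq\mathbb R^{N}$ (the common zero set of finitely many real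 polynomials, not all of $\mathbb R^N$) such that $\operatorname{rank}[\tilde B,\tilde A\tilde B,\dots,\tilde A^{n-1}\tilde B]=k$ for all $\mathbf p\notin V$; and the term rank of a structured matrix is the largest $k$ for which there are $k$ distinct rows $i_1,\dots,i_k$ and $k$ distinct columns $j_1,\dots,j_k$ such that the entries $(i_\ell,j_\ell)$, $\ell=1,\dots,k$, are all $\star$. -/

import Mathlib

namespace StructuralControl

/-- An entry of a structured matrix: a fixed zero, or a free parameter `⋆`. -/
inductive Entry where
  | zero : Entry
  | star : Entry

instance : Zero Entry := ⟨Entry.zero⟩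

/-- A structured matrix, i.e. an element of `{0, ⋆}^{ι × κ}`. -/
abbrev StructMatrix (ι κ : Type*) := Matrix ι κ Entry

section Realizations

variable {n m : ℕ}

/-- The independent parameters of a structured matrix: one for every `⋆`-entry. -/
abbrev Param (M : StructMatrix (Fin n) (Fin m)) : Type :=
  {ij : Fin n × Fin m // M ij.1 ij.2 = Entry.star}

/-- The independent parameters of a symmetrically structured matrix: one for every unordered
pair `{i, j}` (`i = j` allowed) at which the matrix has a `⋆`-entry, so that the entries `(i, j)`
and `(j, i)` share their parameter. -/
abbrev SymParam (M : StructMatrix (Fin n) (Fin n)) : Type :=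
  {e : Sym2 (Fin n) // ∃ i j, e = s(i, j) ∧ M i j = Entry.star}

open Classical in
/-- The numerical realization of a structured matrix with parameter vector `p`. -/
noncomputable def realize (M : StructMatrix (Fin n) (Fin m)) (p : Param M → ℝ) :
    Matrix (Fin n) (Fin m) ℝ :=
  Matrix.of fun i j => if h : M i j = Entry.star then p ⟨(i, j), h⟩ else 0

open Classical in
/-- The numerical realization of a symmetrically structured matrix with parameter vector `p`. -/
noncomputable def symRealize (M : StructMatrix (Fin n) (Fin n)) (p : SymParam M → ℝ) :
    Matrix (Fin n) (Fin n) ℝ :=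
  Matrix.of fun i j =>
    if h : M i j = Entry.star then p ⟨s(i, j), i, j, rfl, h⟩ else 0

/-- The controllability matrix `Q(A, B) = [B, AB, …, A^{n-1}B]`; the column `(k, j)` is the
`j`-th column of `A^k B`. -/
def ctrbMatrix (A : Matrix (Fin n) (Fin n) ℝ) (B : Matrix (Fin n) (Fin m) ℝ) :
    Matrix (Fin n) (Fin n × Fin m) ℝ :=
  Matrix.of fun i kj => (A ^ (kj.1 : ℕ) * B) i kj.2

end Realizations

/-- `V ⊆ ℝ^σ` is a proper variety: the set of common zeros of finitely many real polynomials,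
and not the whole space. -/
def IsProperVariety {σ : Type*} (V : Set (σ → ℝ)) : Prop :=
  (∃ S : Finset (MvPolynomial σ ℝ), V = {x | ∀ φ ∈ S, MvPolynomial.eval x φ = 0}) ∧
    V ≠ Set.univ

/-- The term rank: the largest `k` for which there are `k` distinct rows and `k` distinct columns
such that the entries at the corresponding positions are all `⋆`. -/
noncomputable def termRank {ι κ : Type*} (M : StructMatrix ι κ) : ℕ :=
  sSup {k : ℕ | ∃ (r : Fin k ↪ ι) (c : Fin k ↪ κ), ∀ l, M (r l) (c l) = Entry.star}

/-- For finitely many rows the supremum in the definition of `termRank` is a maximum. -/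
theorem termRank_isGreatest {ι κ : Type*} [Finite ι] (M : StructMatrix ι κ) :
    IsGreatest {k : ℕ | ∃ (r : Fin k ↪ ι) (c : Fin k ↪ κ), ∀ l, M (r l) (c l) = Entry.star}
      (termRank M) := by
  have hb : BddAbove
      {k : ℕ | ∃ (r : Fin k ↪ ι) (c : Fin k ↪ κ), ∀ l, M (r l) (c l) = Entry.star} := by
    refine ⟨Nat.card ι, ?_⟩
    rintro k ⟨r, -, -⟩
    simpa using Nat.card_le_card_of_injective r r.injective
  refine ⟨Nat.sSup_mem ⟨0, ?_⟩ hb, fun k hk => le_csSup hb hk⟩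
  exact ⟨Function.Embedding.ofIsEmpty, Function.Embedding.ofIsEmpty, fun l => l.elim0⟩

section Pairs

variable {n m : ℕ}

/-- The pair `(A, B)` is reducible: after a permutation of the states, given here as a numbering
`e` of the states by `p + q` indices with `q ≥ 1`, it has the form
`A = [A₁₁, 0; 0, A₂₂]`, `B = [B₁; 0]`. The first block may be empty (`p = 0`). -/
def IsReducible (A : StructMatrix (Fin n) (Fin n)) (B : StructMatrix (Fin n) (Fin m)) : Prop :=
  ∃ (p q : ℕ) (_ : 0 < q) (e : Fin p ⊕ Fin q ≃ Fin n)
    (A₁₁ : StructMatrix (Fin p) (Fin p)) (A₂₂ : StructMatrix (Fin q) (Fin q))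
    (B₁ : StructMatrix (Fin p) (Fin m)),
    A.submatrix e e = Matrix.fromBlocks A₁₁ 0 0 A₂₂ ∧
    B.submatrix e id = Matrix.fromRows B₁ 0

/-- The pair `(A, B)` is irreducible. -/
def IsIrreducible (A : StructMatrix (Fin n) (Fin n)) (B : StructMatrix (Fin n) (Fin m)) : Prop :=
  ¬ IsReducible A B

/-- `k` is the generic dimension of the controllable subspace of `(A, B)`, where `A` is
symmetrically structured: outside a proper variety of the parameter space, the controllability
matrix of the numerical realization has rank `k`. -/
def HasGenericControllableDim (A : StructMatrix (Fin n) (Fin n))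
    (B : StructMatrix (Fin n) (Fin m)) (k : ℕ) : Prop :=
  ∃ V : Set (SymParam A ⊕ Param B → ℝ), IsProperVariety V ∧
    ∀ p ∉ V, (ctrbMatrix (symRealize A (p ∘ Sum.inl)) (realize B (p ∘ Sum.inr))).rank = k

end Pairs

end StructuralControl

/-! The upper bound holds for every realization. A left null vector of `[A, B]` annihilates all `A ^
k * B`, so the controllability matrix has rank at most that of `[A, B]`, and a nonzero minor of `[A,
B]` has a nonzero Leibniz term, which is a matching.

For the lower bound, minors are polynomials in the parameters, so one realization of rank at least
the term rank suffices. Let `W` be the left annihilator of all `A ^ k * B`. A symmetric `A`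
preserves `W` and is diagonalizable on it. If no eigenvector with nonzero eigenvalue is annihilated
by the input, then `A` vanishes on `W`, and the controllability matrix has the full rank of `[A, B]`
(`rank_fromCols_le_rank_ctrbMatrix`).

It remains to meet two conditions at once. Nonvanishing of a minor of term-rank size is open, and
attained by symmetric weights on a matching (`exists_symmetric_nonsingular_of_matching`).
Observability of the nonzero modes is dense among symmetric weights once every component of the
state graph meets an input (`IsRooted.exists_near_nonzeroModesObservable`), which irreducibility
guarantees. -/

namespace StructuralControl

/-! ### Observability of the modes with nonzero eigenvalue -/

section Eigenvectors

variable {V : Type*} [Fintype V]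

/-- No eigenvector, for a nonzero eigenvalue, of the principal submatrix of `A` on `S`
is annihilated by `b`. -/
def NonzeroModesObservable (S : Finset V) (A : V → V → ℝ) (b : V → ℝ) : Prop :=
  ∀ μ : ℝ, μ ≠ 0 → ∀ v : V → ℝ, (∀ x ∉ S, v x = 0) →
    (∀ x ∈ S, ∑ y, A x y * v y = μ * v x) → ∑ x, b x * v x = 0 → v = 0

/-- The real eigenvalues of the principal submatrix of `A` on `S`. -/
def spectrumOn (S : Finset V) (A : V → V → ℝ) : Set ℝ :=
  {μ | ∃ v : V → ℝ, v ≠ 0 ∧ (∀ x ∉ S, v x = 0) ∧ ∀ x ∈ S, ∑ y, A x y * v y = μ * v x}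

theorem finite_spectrumOn (S : Finset V) (A : V → V → ℝ) : (spectrumOn S A).Finite := by
  classical
  let M : Matrix V V ℝ := Matrix.of fun x y => if x ∈ S then A x y else 0
  refine (Module.End.finite_hasEigenvalue (Matrix.toLin' M)).subset ?_
  rintro μ ⟨v, hv, hS, he⟩
  refine Module.End.hasEigenvalue_of_hasEigenvector (x := v) ⟨?_, hv⟩
  rw [Module.End.mem_eigenspace_iff, Matrix.toLin'_apply]
  ext x
  by_cases hx : x ∈ S
  · simpa [M, Matrix.mulVec, dotProduct, hx] using he x hx
  · simp [M, Matrix.mulVec, dotProduct, hx, hS x hx]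

/-- A bad `s` gives an eigenvector annihilated by `b + s c`. Two bad parameters cannot share an
eigenvalue: the combination of their eigenvectors that `c` annihilates is zero by hypothesis, and
pairing it with `b` forces the parameters to agree. Hence there are no more bad parameters than
eigenvalues. -/
theorem NonzeroModesObservable.finite_not_add_smul {S : Finset V} {A : V → V → ℝ} {c : V → ℝ}
    (h : NonzeroModesObservable S A c) (b : V → ℝ) :
    {s : ℝ | ¬ NonzeroModesObservable S A fun x => b x + s * c x}.Finite := by
  have key : ∀ s : ℝ, ¬ NonzeroModesObservable S A (fun x => b x + s * c x) →
      ∃ μ : ℝ, μ ≠ 0 ∧ ∃ v : V → ℝ, (∀ x ∉ S, v x = 0) ∧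
        (∀ x ∈ S, ∑ y, A x y * v y = μ * v x) ∧
        ∑ x, (b x + s * c x) * v x = 0 ∧ v ≠ 0 := by
    intro s hs
    unfold NonzeroModesObservable at hs
    push Not at hs
    exact hs
  choose! μ hμ v hvS hv hb hv0 using key
  refine Set.Finite.of_finite_image (f := μ) ((finite_spectrumOn S A).subset ?_) ?_
  · rintro _ ⟨s, hs, rfl⟩
    exact ⟨v s, hv0 s hs, hvS s hs, hv s hs⟩
  · intro s hs t ht hst
    have hbs : ∀ s, ¬ NonzeroModesObservable S A (fun x => b x + s * c x) →
        ∑ x, b x * v s x + s * ∑ x, c x * v s x = 0 := by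
      intro s hs
      rw [← hb s hs, Finset.mul_sum, ← Finset.sum_add_distrib]
      exact Finset.sum_congr rfl fun x _ => by ring
    have hcne : ∀ s, ¬ NonzeroModesObservable S A (fun x => b x + s * c x) →
        ∑ x, c x * v s x ≠ 0 := fun s hs h0 =>
      hv0 s hs (h (μ s) (hμ s hs) _ (hvS s hs) (hv s hs) h0)
    have hlin : ∀ (d : V → ℝ) (α β : ℝ), ∑ x, d x * (α * v s x - β * v t x) =
        α * ∑ x, d x * v s x - β * ∑ x, d x * v t x := by
      intro d α β
      rw [Finset.mul_sum, Finset.mul_sum, ← Finset.sum_sub_distrib]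
      exact Finset.sum_congr rfl fun x _ => by ring
    have hw := h (μ s) (hμ s hs)
      (fun x => (∑ x, c x * v t x) * v s x - (∑ x, c x * v s x) * v t x)
      (fun x hx => by simp [hvS s hs x hx, hvS t ht x hx])
      (fun x hx => by
        rw [hlin, hv s hs x hx, hv t ht x hx, ← hst]; ring)
      (by rw [hlin]; ring)
    have hbw : ∑ x, b x * ((∑ x, c x * v t x) * v s x - (∑ x, c x * v s x) * v t x) = 0 :=
      Finset.sum_eq_zero fun x _ => by
        have := congrFun hw x
        simp only [Pi.zero_apply] at this
        rw [this, mul_zero]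
    rw [hlin] at hbw
    have h1 := hbs s hs
    have h2 := hbs t ht
    have h3 : (∑ x, c x * v s x) * (∑ x, c x * v t x) * (t - s) = 0 := by
      linear_combination hbw - (∑ x, c x * v t x) * h1 + (∑ x, c x * v s x) * h2
    rcases mul_eq_zero.1 h3 with h4 | h4
    · exact absurd h4 (mul_ne_zero (hcne s hs) (hcne t ht))
    · linarith

theorem exists_abs_sub_lt_notMem {F : Set ℝ} (hF : F.Finite) (a : ℝ) {ε : ℝ} (hε : 0 < ε) :
    ∃ s, |s - a| < ε ∧ s ∉ F := by
  obtain ⟨s, hs, hsF⟩ := ((Set.Ioo_infinite (show a - ε < a + ε by linarith)).sdiff hF).nonempty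
  exact ⟨s, abs_sub_lt_iff.2 ⟨by linarith [hs.2], by linarith [hs.1]⟩, hsF⟩

/-- Adjoining a vertex `i`: the input enters at `i`, and row `i` of `A` acts
as the input of the remaining vertices. -/
theorem NonzeroModesObservable.insert [DecidableEq V] {S : Finset V} {i : V}
    {A : V → V → ℝ} (h : NonzeroModesObservable S A (A i)) :
    NonzeroModesObservable (insert i S) A (Pi.single i 1) := by
  intro μ hμ v hvS hv hb
  have hvi : v i = 0 := by simpa [Pi.single_apply] using hb
  refine h μ hμ v (fun x hx => ?_) (fun x hx => hv x (Finset.mem_insert_of_mem hx)) ?_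
  · by_cases hxi : x = i
    · rw [hxi, hvi]
    · exact hvS x (by simp [hxi, hx])
  · rw [hv i (Finset.mem_insert_self _ _), hvi, mul_zero]

theorem NonzeroModesObservable.congr {S : Finset V} {A A' : V → V → ℝ} {b b' : V → ℝ}
    (h : NonzeroModesObservable S A b) (hA : ∀ x ∈ S, ∀ y ∈ S, A' x y = A x y)
    (hb : ∀ x ∈ S, b' x = b x) : NonzeroModesObservable S A' b' := by
  intro μ hμ v hvS hv hbv
  refine h μ hμ v hvS (fun x hx => ?_) ?_
  · rw [← hv x hx]
    refine Finset.sum_congr rfl fun y _ => ?_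
    by_cases hy : y ∈ S
    · rw [hA x hx y hy]
    · rw [hvS y hy, mul_zero, mul_zero]
  · rw [← hbv]
    refine Finset.sum_congr rfl fun y _ => ?_
    by_cases hy : y ∈ S
    · rw [hb y hy]
    · rw [hvS y hy, mul_zero, mul_zero]

/-- With no edges between `S` and `T`, an eigenvector splits into two restrictions with the same
eigenvalue. Since the spectra share no nonzero value, one restriction vanishes, so the contributions
of the two sides to the output cannot cancel. -/
theorem NonzeroModesObservable.union [DecidableEq V] {S T : Finset V} {A : V → V → ℝ} {b : V → ℝ}
    (hST : Disjoint S T) (hS : NonzeroModesObservable S A b) (hT : NonzeroModesObservable T A b)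
    (hA : ∀ x ∈ S, ∀ y ∈ T, A x y = 0) (hA' : ∀ x ∈ T, ∀ y ∈ S, A x y = 0)
    (hsp : ∀ μ ∈ spectrumOn S A, μ ∈ spectrumOn T A → μ = 0) :
    NonzeroModesObservable (S ∪ T) A b := by
  intro μ hμ v hv0 hv hb
  let vS : V → ℝ := fun x => if x ∈ S then v x else 0
  let vT : V → ℝ := fun x => if x ∈ T then v x else 0
  have hvST : ∀ x, v x = vS x + vT x := by
    intro x
    by_cases h1 : x ∈ S
    · simp [vS, vT, h1, Finset.disjoint_left.1 hST h1]
    · by_cases h2 : x ∈ T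
      · simp [vS, vT, h1, h2]
      · simp [vS, vT, h1, h2, hv0 x (by simp [h1, h2])]
  have hS0 : ∀ x ∉ S, vS x = 0 := fun x hx => by simp [vS, hx]
  have hT0 : ∀ x ∉ T, vT x = 0 := fun x hx => by simp [vT, hx]
  have hSe : ∀ x ∈ S, ∑ y, A x y * vS y = μ * vS x := by
    intro x hx
    have h1 := hv x (Finset.mem_union_left _ hx)
    have h2 : ∑ y, A x y * v y = ∑ y, A x y * vS y := by
      refine Finset.sum_congr rfl fun y _ => ?_
      by_cases hy : y ∈ T
      · rw [hA x hx y hy, zero_mul, zero_mul]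
      · rw [hvST, hT0 y hy, add_zero]
    rw [← h2, h1, hvST, hT0 x (Finset.disjoint_left.1 hST hx), add_zero]
  have hTe : ∀ x ∈ T, ∑ y, A x y * vT y = μ * vT x := by
    intro x hx
    have h1 := hv x (Finset.mem_union_right _ hx)
    have h2 : ∑ y, A x y * v y = ∑ y, A x y * vT y := by
      refine Finset.sum_congr rfl fun y _ => ?_
      by_cases hy : y ∈ S
      · rw [hA' x hx y hy, zero_mul, zero_mul]
      · rw [hvST, hS0 y hy, zero_add]
    rw [← h2, h1, hvST, hS0 x (Finset.disjoint_right.1 hST hx), zero_add]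
  have hbsum : ∑ x, b x * vS x + ∑ x, b x * vT x = 0 := by
    rw [← hb, ← Finset.sum_add_distrib]
    exact Finset.sum_congr rfl fun x _ => by rw [hvST]; ring
  have hzero : vS = 0 ∧ vT = 0 := by
    by_cases h1 : vS = 0
    · refine ⟨h1, hT μ hμ vT hT0 hTe ?_⟩
      simpa [h1] using hbsum
    · by_cases h2 : vT = 0
      · exact ⟨hS μ hμ vS hS0 hSe (by simpa [h2] using hbsum), h2⟩
      · exact absurd (hsp μ ⟨vS, h1, hS0, hSe⟩ ⟨vT, h2, hT0, hTe⟩) hμ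
  ext x
  rw [hvST, hzero.1, hzero.2]
  simp

theorem spectrumOn_congr {S : Finset V} {A A' : V → V → ℝ}
    (hA : ∀ x ∈ S, ∀ y ∈ S, A' x y = A x y) : spectrumOn S A' ⊆ spectrumOn S A := by
  rintro μ ⟨v, hv, hvS, he⟩
  refine ⟨v, hv, hvS, fun x hx => ?_⟩
  rw [← he x hx]
  refine Finset.sum_congr rfl fun y _ => ?_
  by_cases hy : y ∈ S
  · rw [hA x hx y hy]
  · rw [hvS y hy, mul_zero, mul_zero]

theorem mem_spectrumOn_of_smul {S : Finset V} {A : V → V → ℝ} {s : ℝ} (hs : s ≠ 0) {μ : ℝ}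
    (hμ : μ ∈ spectrumOn S fun x y => s * A x y) : s⁻¹ * μ ∈ spectrumOn S A := by
  obtain ⟨v, hv, hvS, he⟩ := hμ
  refine ⟨v, hv, hvS, fun x hx => ?_⟩
  have := he x hx
  simp only [mul_assoc] at this
  rw [← Finset.mul_sum] at this
  field_simp
  rw [mul_comm]
  exact this

theorem NonzeroModesObservable.smul {S : Finset V} {A : V → V → ℝ} {b : V → ℝ}
    (h : NonzeroModesObservable S A b) {s : ℝ} (hs : s ≠ 0) :
    NonzeroModesObservable S (fun x y => s * A x y) b := by
  intro μ hμ v hvS he hb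
  refine h (s⁻¹ * μ) (mul_ne_zero (inv_ne_zero hs) hμ) v hvS (fun x hx => ?_) hb
  have := he x hx
  simp only [mul_assoc] at this
  rw [← Finset.mul_sum] at this
  field_simp
  rw [mul_comm]
  exact this

end Eigenvectors

/-! ### Density of observable symmetric weights on rooted graphs -/

section Density

variable {V : Type*} [Fintype V] [DecidableEq V]

/-- Every nonempty subset of `S` that is closed under adjacency within `S` contains a root, i.e.
every connected component of the graph induced on `S` does. -/
def IsRooted (G : V → V → Prop) (S : Finset V) (R : V → Prop) : Prop :=
  ∀ T ⊆ S, T.Nonempty → (∀ x ∈ T, ∀ y ∈ S, G x y → y ∈ T) → ∃ r ∈ T, R r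

/-- A rooted graph splits into the component of some root `i`, which without `i` is rooted at the
neighbours of `i`, and a rooted remainder. -/
theorem IsRooted.exists_split {G : V → V → Prop} (hG : ∀ x y, G x y → G y x) {S : Finset V}
    {R : V → Prop} (h : IsRooted G S R) (hS : S.Nonempty) :
    ∃ (i : V) (S₁ S₂ : Finset V), R i ∧ i ∉ S₁ ∧ Disjoint (insert i S₁) S₂ ∧
      insert i S₁ ∪ S₂ = S ∧ IsRooted G S₁ (G i) ∧ IsRooted G S₂ R ∧
      (∀ x ∈ insert i S₁, ∀ y ∈ S₂, ¬ G x y) := by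
  classical
  obtain ⟨i, hiS, hiR⟩ := h S subset_rfl hS fun _ _ _ hy _ => hy
  -- `K` is the component of `i`, as the intersection of all closed subsets of `S` containing `i`.
  let K : Finset V := S.filter fun x =>
    ∀ T ⊆ S, (∀ x ∈ T, ∀ y ∈ S, G x y → y ∈ T) → i ∈ T → x ∈ T
  have hKS : K ⊆ S := Finset.filter_subset _ _
  have hiK : i ∈ K := Finset.mem_filter.2 ⟨hiS, fun _ _ _ h => h⟩
  have hKcl : ∀ x ∈ K, ∀ y ∈ S, G x y → y ∈ K := fun x hx y hy hxy =>
    Finset.mem_filter.2 ⟨hy, fun T hT hTc hiT =>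
      hTc x ((Finset.mem_filter.1 hx).2 T hT hTc hiT) y hy hxy⟩
  have hins : insert i (K.erase i) = K := Finset.insert_erase hiK
  refine ⟨i, K.erase i, S \ K, hiR, Finset.notMem_erase _ _, ?_, ?_, ?_, ?_, ?_⟩
  · rw [hins]; exact Finset.disjoint_sdiff
  · rw [hins]; exact Finset.union_sdiff_of_subset hKS
  · intro T hT hTne hTc
    by_contra! hno
    have hTK : ∀ x ∈ T, x ∈ K := fun x hx => Finset.mem_of_mem_erase (hT hx)
    have hTi : i ∉ T := fun hi => Finset.notMem_erase i K (hT hi)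
    have hTcS : ∀ x ∈ T, ∀ y ∈ S, G x y → y ∈ T := by
      intro x hx y hy hxy
      have hyi : y ≠ i := fun e => hno x hx (e ▸ hG _ _ hxy)
      exact hTc x hx y (Finset.mem_erase.2 ⟨hyi, hKcl x (hTK x hx) y hy hxy⟩) hxy
    obtain ⟨x, hx⟩ := hTne
    -- Having no neighbour of `i`, `T` is closed in `S`; by symmetry so is `S \ T`, which contains
    -- `i` and would therefore contain all of `K`.
    have := (Finset.mem_filter.1 (hTK x hx)).2 (S \ T) Finset.sdiff_subset ?_
      (Finset.mem_sdiff.2 ⟨hiS, hTi⟩)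
    · exact (Finset.mem_sdiff.1 this).2 hx
    · intro a ha b hb hab
      refine Finset.mem_sdiff.2 ⟨hb, fun hbT => (Finset.mem_sdiff.1 ha).2 ?_⟩
      exact hTcS b hbT a (Finset.mem_sdiff.1 ha).1 (hG _ _ hab)
  · intro T hT hTne hTc
    refine h T (hT.trans Finset.sdiff_subset) hTne fun x hx y hy hxy => ?_
    refine hTc x hx y (Finset.mem_sdiff.2 ⟨hy, fun hyK => ?_⟩) hxy
    have := Finset.mem_sdiff.1 (hT hx)
    exact this.2 (hKcl y hyK x this.1 (hG _ _ hxy))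
  · rw [hins]
    intro x hx y hy hxy
    have := Finset.mem_sdiff.1 hy
    exact this.2 (hKcl x hx y this.1 hxy)

/-- On a rooted graph the symmetric weights whose nonzero modes are all observable are dense. -/
theorem IsRooted.exists_near_nonzeroModesObservable {G : V → V → Prop}
    (hG : ∀ x y, G x y → G y x) {S : Finset V} {R : V → Prop} (h : IsRooted G S R)
    {A₀ : V → V → ℝ} (hsym : ∀ x y, A₀ x y = A₀ y x) (hA₀ : ∀ x y, A₀ x y ≠ 0 → G x y)
    {b₀ : V → ℝ} (hb₀ : ∀ x, b₀ x ≠ 0 → R x) {ε : ℝ} (hε : 0 < ε) :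
    ∃ (A : V → V → ℝ) (b : V → ℝ), (∀ x y, A x y = A y x) ∧ (∀ x y, A x y ≠ 0 → G x y) ∧
      (∀ x, b x ≠ 0 → R x) ∧ (∀ x y, |A x y - A₀ x y| < ε) ∧ (∀ x, |b x - b₀ x| < ε) ∧
      NonzeroModesObservable S A b := by
  induction S using Finset.strongInduction generalizing R A₀ b₀ ε with
  | H S ih =>
  rcases S.eq_empty_or_nonempty with rfl | hS
  · exact ⟨A₀, b₀, hsym, hA₀, hb₀, by simp [hε], by simp [hε],
      fun _ _ v hv _ _ => funext fun x => hv x (by simp)⟩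
  obtain ⟨i, S₁, S₂, hiR, hi₁, hdisj, hun, hr₁, hr₂, hno⟩ := h.exists_split hG hS
  have hiS₂ : i ∉ S₂ := Finset.disjoint_left.1 hdisj (Finset.mem_insert_self _ _)
  have hdisj' : ∀ x ∈ S₁, x ∉ S₂ := fun x hx =>
    Finset.disjoint_left.1 hdisj (Finset.mem_insert_of_mem hx)
  have hlt₁ : S₁ ⊂ S := by
    refine Finset.ssubset_iff.2 ⟨i, hi₁, ?_⟩
    rw [← hun]; exact Finset.subset_union_left
  have hlt₂ : S₂ ⊂ S := by
    refine Finset.ssubset_iff.2 ⟨i, hiS₂, ?_⟩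
    rw [← hun]
    exact Finset.insert_subset (Finset.mem_union_left _ (Finset.mem_insert_self _ _))
      Finset.subset_union_right
  -- On `S₁` the reference input is row `i` of `A₀`: the edges at `i` act as input weights. On `S₂`
  -- the tolerance is halved to leave room for a later rescaling.
  obtain ⟨A₁, c₁, hs₁, hG₁, hc₁, hnA₁, hnc₁, hQ₁⟩ := ih S₁ hlt₁ hr₁ hsym hA₀ (hA₀ i) hε
  obtain ⟨A₂, b₂, hs₂, hG₂, hb₂, hnA₂, -, hQ₂⟩ := ih S₂ hlt₂ hr₂ hsym hA₀ hb₀ (half_pos hε)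
  let AK : V → V → ℝ := fun x y =>
    if x ∈ S₁ ∧ y ∈ S₁ then A₁ x y else if x = i ∧ y ∈ S₁ then c₁ y
    else if x ∈ S₁ ∧ y = i then c₁ x else A₀ x y
  have hAKi : ∀ y ∈ S₁, AK i y = c₁ y := fun y hy => by simp [AK, hi₁, hy]
  have hAK₁ : ∀ x ∈ S₁, ∀ y ∈ S₁, AK x y = A₁ x y := fun x hx y hy => by simp [AK, hx, hy]
  have hAKsym : ∀ x y, AK x y = AK y x := by
    intro x y
    by_cases hx : x ∈ S₁ <;> by_cases hy : y ∈ S₁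
    · simp [AK, hx, hy, hs₁ x y]
    · by_cases hyi : y = i
      · simp [AK, hx, hi₁, hyi]
      · simp [AK, hx, hy, hyi, hsym x y]
    · by_cases hxi : x = i
      · simp [AK, hy, hi₁, hxi]
      · simp [AK, hx, hy, hxi, hsym x y]
    · simp [AK, hx, hy, hsym x y]
  have hAKG : ∀ x y, AK x y ≠ 0 → G x y := by
    intro x y hxy
    simp only [AK] at hxy
    split_ifs at hxy with h1 h2 h3
    · exact hG₁ _ _ hxy
    · exact h2.1 ▸ hc₁ _ hxy
    · exact h3.2 ▸ hG _ _ (hc₁ _ hxy)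
    · exact hA₀ _ _ hxy
  have hAKn : ∀ x y, |AK x y - A₀ x y| < ε := by
    intro x y
    simp only [AK]
    split_ifs with h1 h2 h3
    · exact hnA₁ _ _
    · exact h2.1 ▸ hnc₁ _
    · rw [h3.2, hsym]; exact hnc₁ _
    · simpa using hε
  have hQK : NonzeroModesObservable (insert i S₁) AK (Pi.single i 1) :=
    NonzeroModesObservable.insert (hQ₁.congr hAK₁ hAKi)
  -- A scaling factor for `A₂` outside these ratios leaves no nonzero eigenvalue common to the two
  -- sides.
  have hF : ({0} ∪ Set.image2 (fun μ ν : ℝ => μ / ν) (spectrumOn (insert i S₁) AK)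
      (spectrumOn S₂ A₂)).Finite :=
    (Set.finite_singleton _).union
      ((finite_spectrumOn _ _).image2 _ (finite_spectrumOn _ _))
  have hN : 0 < 1 + ∑ x, ∑ y, |A₂ x y| := by positivity
  obtain ⟨s, hs1, hsF⟩ := exists_abs_sub_lt_notMem hF 1 (div_pos (half_pos hε) hN)
  have hs0 : s ≠ 0 := fun h0 => hsF (Or.inl h0)
  let A : V → V → ℝ := fun x y => if x ∈ S₂ ∧ y ∈ S₂ then s * A₂ x y else AK x y
  have hA₂ : ∀ x ∈ S₂, ∀ y ∈ S₂, A x y = s * A₂ x y := fun x hx y hy => by simp [A, hx, hy]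
  have hAK : ∀ x ∈ insert i S₁, ∀ y ∈ insert i S₁, A x y = AK x y := fun x hx y _ => by
    simp [A, Finset.disjoint_left.1 hdisj hx]
  have hAsym : ∀ x y, A x y = A y x := by
    intro x y
    simp only [A, and_comm (a := y ∈ S₂), hs₂ y x, hAKsym y x]
  have hAG : ∀ x y, A x y ≠ 0 → G x y := by
    intro x y hxy
    simp only [A] at hxy
    split_ifs at hxy with h1
    · exact hG₂ _ _ (right_ne_zero_of_mul hxy)
    · exact hAKG _ _ hxy
  have hAn : ∀ x y, |A x y - A₀ x y| < ε := by
    intro x y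
    simp only [A]
    split_ifs with h1
    · have h2 : |A₂ x y| ≤ ∑ x, ∑ y, |A₂ x y| :=
        (Finset.single_le_sum (f := fun y => |A₂ x y|) (fun _ _ => abs_nonneg _)
          (Finset.mem_univ y)).trans
        (Finset.single_le_sum (f := fun x => ∑ y, |A₂ x y|)
          (fun _ _ => Finset.sum_nonneg fun _ _ => abs_nonneg _) (Finset.mem_univ x))
      have h3 : |s - 1| * |A₂ x y| ≤ ε / 2 := by
        calc |s - 1| * |A₂ x y| ≤
              ε / 2 / (1 + ∑ x, ∑ y, |A₂ x y|) * (1 + ∑ x, ∑ y, |A₂ x y|) := by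
              gcongr
              linarith
          _ = ε / 2 := div_mul_cancel₀ _ hN.ne'
      calc |s * A₂ x y - A₀ x y| = |(s - 1) * A₂ x y + (A₂ x y - A₀ x y)| := by ring_nf
        _ ≤ |(s - 1) * A₂ x y| + |A₂ x y - A₀ x y| := abs_add_le _ _
        _ < ε / 2 + ε / 2 := by
          rw [abs_mul]
          exact add_lt_add_of_le_of_lt h3 (hnA₂ x y)
        _ = ε := add_halves ε
    · exact hAKn _ _
  have hA0 : ∀ x ∈ insert i S₁, ∀ y ∈ S₂, A x y = 0 := fun x hx y hy => by
    by_contra hne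
    exact hno x hx y hy (hAG x y hne)
  -- `c` need not be close to `b₀`. It only shows that some input works, whence `b₀ + t c` works for
  -- all but finitely many `t`, in particular for some small `t`.
  let c : V → ℝ := fun x => if x ∈ S₂ then b₂ x else (Pi.single i 1 : V → ℝ) x
  have hQ : NonzeroModesObservable S A c := by
    rw [← hun]
    refine NonzeroModesObservable.union hdisj (hQK.congr hAK fun x hx => ?_)
      ((hQ₂.smul hs0).congr hA₂ fun x hx => ?_) hA0
      (fun x hx y hy => by rw [hAsym]; exact hA0 y hy x hx) ?_
    · simp [c, Finset.disjoint_left.1 hdisj hx]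
    · simp [c, hx]
    · intro μ hμ hμ'
      by_contra hne
      have h2 := mem_spectrumOn_of_smul hs0 (spectrumOn_congr hA₂ hμ')
      refine hsF (Or.inr ⟨μ, spectrumOn_congr hAK hμ, s⁻¹ * μ, h2, ?_⟩)
      change μ / (s⁻¹ * μ) = s
      field_simp
  have hcR : ∀ x, c x ≠ 0 → R x := by
    intro x hx
    simp only [c] at hx
    split_ifs at hx with h1
    · exact hb₂ x hx
    · by_cases hxi : x = i
      · exact hxi ▸ hiR
      · simp [hxi] at hx
  have hM : 0 < 1 + ∑ x, |c x| := by positivity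
  obtain ⟨t, ht0, htF⟩ := exists_abs_sub_lt_notMem (hQ.finite_not_add_smul b₀) 0 (div_pos hε hM)
  refine ⟨A, fun x => b₀ x + t * c x, hAsym, hAG, fun x hx => ?_, hAn, fun x => ?_,
    not_not.1 htF⟩
  · by_cases hb : b₀ x = 0
    · exact hcR x (by intro h0; simp [hb, h0] at hx)
    · exact hb₀ x hb
  · rw [sub_zero] at ht0
    have h2 : |c x| ≤ ∑ x, |c x| :=
      Finset.single_le_sum (f := fun x => |c x|) (fun _ _ => abs_nonneg _) (Finset.mem_univ x)
    rw [add_sub_cancel_left, abs_mul]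
    calc |t| * |c x| ≤ |t| * (1 + ∑ x, |c x|) := by gcongr; linarith
      _ < ε / (1 + ∑ x, |c x|) * (1 + ∑ x, |c x|) := by gcongr
      _ = ε := div_mul_cancel₀ _ hM.ne'

end Density

/-! ### Nonsingular symmetric weights on permutations and matchings -/

/-- Nonsingularity of a symmetric matrix on the edges `{x, σ x}` of a permutation, for suitable
weights: alternate edges are kept on the cycles of even length, all edges on the odd ones. -/
theorem exists_weights_perm {ι : Type*} (σ : Equiv.Perm ι) :
    ∃ c : ι → ℝ, ∀ v : ι → ℝ, (∀ x, c (σ x) * v (σ (σ x)) + c x * v x = 0) → v = 0 := by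
  classical
  -- `P` marks the cycles of odd length; off them, `E` marks every other point, by parity of the
  -- distance from a chosen representative.
  let P : ι → Prop := fun x => ∃ k : ℤ, Odd k ∧ (σ ^ k) x = x
  let rep : ι → ι := fun x => (Quotient.mk (Equiv.Perm.SameCycle.setoid σ) x).out
  let E : ι → Prop := fun x => ∃ k : ℤ, Even k ∧ (σ ^ k) (rep x) = x
  have hrep : ∀ x, ∃ k : ℤ, (σ ^ k) (rep x) = x := fun x =>
    Quotient.exact (s := Equiv.Perm.SameCycle.setoid σ) (Quotient.out_eq (Quotient.mk _ x))
  have hrepσ : ∀ x, rep (σ x) = rep x := fun x => by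
    refine congrArg Quotient.out (Quotient.sound (s := Equiv.Perm.SameCycle.setoid σ) ?_)
    exact ⟨-1, by simp⟩
  have hPσ : ∀ x, P (σ x) ↔ P x := by
    intro x
    refine exists_congr fun k => and_congr_right fun _ => ?_
    rw [← Equiv.Perm.mul_apply, (Commute.refl σ).zpow_left k |>.eq, Equiv.Perm.mul_apply,
      σ.injective.eq_iff]
  have hEσ : ∀ x, ¬ P x → (E (σ x) ↔ ¬ E x) := by
    intro x hx
    constructor
    · rintro ⟨l, hl, hl'⟩ ⟨k, hk, hk'⟩
      refine hx ⟨k + 1 - l, by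
        rcases hl with ⟨a, rfl⟩; rcases hk with ⟨b, rfl⟩; exact ⟨b - a, by ring⟩, ?_⟩
      rw [hrepσ] at hl'
      have h1 : (σ ^ (k + 1)) (rep x) = σ x := by
        rw [add_comm, zpow_add, zpow_one, Equiv.Perm.mul_apply, hk']
      have h2 : (σ ^ (k + 1 - l)) (σ x) = σ x := by
        rw [← hl', ← Equiv.Perm.mul_apply, ← zpow_add, sub_add_cancel, h1, hl']
      rw [← Equiv.Perm.mul_apply, (Commute.refl σ).zpow_left _ |>.eq, Equiv.Perm.mul_apply,
        σ.injective.eq_iff] at h2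
      exact h2
    · intro hE
      obtain ⟨j, hj⟩ := hrep x
      have hjo : Odd j := Int.not_even_iff_odd.1 fun h => hE ⟨j, h, hj⟩
      refine ⟨1 + j, Odd.add_odd odd_one hjo, ?_⟩
      rw [hrepσ, zpow_add, zpow_one, Equiv.Perm.mul_apply, hj]
  refine ⟨fun x => if P x ∨ E x then 1 else 0, fun v hv => funext fun x => ?_⟩
  by_cases hx : P x
  -- On an odd cycle each double step changes the sign of `v`; an odd number of double steps returns
  -- to the start, so `v x = -v x`.
  · have hstep : ∀ m : ℕ, P ((σ ^ m) x) ∧ v ((σ ^ (2 * m)) x) = (-1) ^ m * v x := by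
      have hPm : ∀ m : ℕ, P ((σ ^ m) x) := by
        intro m
        induction m with
        | zero => simpa using hx
        | succ m ih => rw [pow_succ', Equiv.Perm.mul_apply, hPσ]; exact ih
      intro m
      refine ⟨hPm m, ?_⟩
      induction m with
      | zero => simp
      | succ m ih =>
        have := hv ((σ ^ (2 * m)) x)
        beta_reduce at this
        rw [if_pos (Or.inl ((hPσ _).2 (hPm _))), if_pos (Or.inl (hPm _)), ih] at this
        have e : (σ ^ (2 * (m + 1))) x = σ (σ ((σ ^ (2 * m)) x)) := by
          rw [show 2 * (m + 1) = 2 * m + 1 + 1 by ring, pow_succ', pow_succ']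
          rfl
        rw [e, pow_succ]
        linarith
    obtain ⟨k, hk, hkx⟩ := hx
    have hkx' : (σ ^ k.natAbs) x = x := by
      rcases Int.natAbs_eq k with h | h
      · rw [h, zpow_natCast] at hkx; exact hkx
      · rw [h, zpow_neg, zpow_natCast, Equiv.Perm.inv_eq_iff_eq] at hkx
        exact hkx.symm
    have h2 := (hstep k.natAbs).2
    rw [two_mul, pow_add, Equiv.Perm.mul_apply, hkx', hkx', (Int.natAbs_odd.2 hk).neg_one_pow] at h2
    simp only [Pi.zero_apply]
    linarith
  -- Off the odd cycles exactly one of two consecutive weights is nonzero, so each equation isolates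
  -- one coordinate.
  · by_cases hE : E x
    · have := hv x
      beta_reduce at this
      rw [if_neg (not_or.2 ⟨fun h => hx ((hPσ x).1 h), fun h => (hEσ x hx).1 h hE⟩),
        if_pos (Or.inr hE)] at this
      simpa using this
    · obtain ⟨y, rfl⟩ : ∃ y, σ (σ y) = x := ⟨σ.symm (σ.symm x), by simp⟩
      have hP1 : ¬ P (σ y) := fun h => hx ((hPσ _).2 h)
      have hP0 : ¬ P y := fun h => hP1 ((hPσ _).2 h)
      have hE1 : E (σ y) := not_not.1 fun h => hE ((hEσ _ hP1).2 h)
      have hE0 : ¬ E y := (hEσ _ hP0).1 hE1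
      have := hv y
      beta_reduce at this
      rw [if_neg (not_or.2 ⟨hP0, hE0⟩), if_pos (Or.inr hE1)] at this
      simpa using this

section Matching

variable {V U : Type*} [DecidableEq V] [DecidableEq U]

/-- The weight `c x` is put on the edge `{x, σ x}`. Row `σ x` then meets only the columns `σ (σ x)`
and `x`, which gives the system of `exists_weights_perm` after relabelling the unknowns by `σ`. -/
theorem exists_symmetric_nonsingular_of_perm (X : Finset V) (σ : Equiv.Perm X) :
    ∃ A : V → V → ℝ, (∀ x y, A x y = A y x) ∧
      (∀ x y, A x y ≠ 0 → (∃ h : x ∈ X, (σ ⟨x, h⟩ : V) = y) ∨ ∃ h : y ∈ X, (σ ⟨y, h⟩ : V) = x) ∧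
      ∀ w : X → ℝ, (∀ x : X, ∑ y : X, A x (σ y) * w y = 0) → w = 0 := by
  obtain ⟨c, hc⟩ := exists_weights_perm σ
  let A' : X → X → ℝ := fun x y =>
    (if y = σ x then c x else 0) + (if x = σ y then c y else 0)
  refine ⟨fun x y => if h : x ∈ X ∧ y ∈ X then A' ⟨x, h.1⟩ ⟨y, h.2⟩ else 0, ?_, ?_, ?_⟩
  · intro x y
    by_cases hx : x ∈ X <;> by_cases hy : y ∈ X <;> simp [hx, hy, A', add_comm]
  · intro x y hxy
    by_cases hx : x ∈ X <;> by_cases hy : y ∈ X <;> simp only [hx, hy] at hxy ⊢ <;>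
      simp only [and_self, and_true, dite_true, dite_false, ne_eq, not_true_eq_false,
        and_false] at hxy
    by_contra! hne
    apply hxy
    simp only [A']
    rw [if_neg, if_neg, add_zero]
    · exact fun e => hne.2 trivial (congrArg Subtype.val e).symm
    · exact fun e => hne.1 trivial (congrArg Subtype.val e).symm
  · intro w hw
    have := hc (fun y => w (σ.symm y)) fun x => ?_
    · ext y
      simpa using congrFun this (σ y)
    · have h1 := hw (σ x)
      rw [← Equiv.sum_comp σ.symm] at h1
      simp only [Equiv.apply_symm_apply, Finset.coe_mem, and_self, dite_true, A', add_mul,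
        Finset.sum_add_distrib, ite_mul, zero_mul, Subtype.coe_eta, σ.injective.eq_iff] at h1
      simpa using h1

/-- Along a matching `f` of the rows `X` into the columns of `[A, B]` there are values, with `A`
symmetric, for which the matched minor is nonsingular. -/
theorem exists_symmetric_nonsingular_of_matching (X : Finset V) (f : V → V ⊕ U)
    (hf : Set.InjOn f X) :
    ∃ (A : V → V → ℝ) (B : V → U → ℝ), (∀ x y, A x y = A y x) ∧
      (∀ x y, A x y ≠ 0 → (x ∈ X ∧ f x = Sum.inl y) ∨ (y ∈ X ∧ f y = Sum.inl x)) ∧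
      (∀ x u, B x u ≠ 0 → x ∈ X ∧ f x = Sum.inr u) ∧
      ∀ w : V → ℝ, (∀ x ∈ X, ∑ y ∈ X, Sum.elim (A x) (B x) (f y) * w y = 0) →
        ∀ x ∈ X, w x = 0 := by
  induction X using Finset.strongInduction with
  | H X ih =>
  -- If every state of `X` is a matched column, counting makes `f` a permutation of `X`.
  by_cases hcov : ∀ x ∈ X, ∃ y ∈ X, f y = Sum.inl x
  · choose! g hgX hg using hcov
    let g' : X → X := fun x => ⟨g x, hgX x x.2⟩
    have hg' : Function.Injective g' := fun x y hxy => by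
      have h1 : g x = g y := congrArg Subtype.val hxy
      have h2 := hg x x.2
      rw [h1, hg y y.2] at h2
      exact Subtype.ext (Sum.inl_injective h2).symm
    let σ : Equiv.Perm X := (Equiv.ofBijective g' (Finite.injective_iff_bijective.1 hg')).symm
    have hσ : ∀ x : X, f x = Sum.inl (σ x : V) := by
      intro x
      have h1 := hg (σ x) (σ x).2
      have h2 : g' (σ x) = x := Equiv.ofBijective_apply_symm_apply g' _ x
      rwa [show g (σ x) = x from congrArg Subtype.val h2] at h1
    obtain ⟨A, hsym, hsupp, hns⟩ := exists_symmetric_nonsingular_of_perm X σ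
    refine ⟨A, fun _ _ => 0, hsym, fun x y hxy => ?_, by simp, fun w hw x hx => ?_⟩
    · refine (hsupp x y hxy).imp ?_ ?_
      · rintro ⟨h, rfl⟩; exact ⟨h, hσ ⟨x, h⟩⟩
      · rintro ⟨h, rfl⟩; exact ⟨h, hσ ⟨y, h⟩⟩
    · refine congrFun (hns (fun y => w y) fun x => ?_) ⟨x, hx⟩
      rw [← hw x x.2, ← Finset.sum_coe_sort X]
      exact Finset.sum_congr rfl fun y _ => by rw [hσ y]; rfl
  · push Not at hcov
    obtain ⟨x₀, hx₀, hno⟩ := hcov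
    obtain ⟨A, B, hsym, hA, hB, hns⟩ := ih (X.erase x₀) (Finset.erase_ssubset hx₀)
      (hf.mono (Finset.coe_subset.2 (Finset.erase_subset _ _)))
    -- Column `x₀` is unmatched, so the mirror image of a new entry `(x₀, f x₀)` of `A` falls
    -- outside the minor. Row `x₀` of the minor has that entry alone, and the induction hypothesis
    -- handles the other rows.
    let A' : V → V → ℝ := fun x y =>
      if (x = x₀ ∧ f x₀ = Sum.inl y) ∨ (y = x₀ ∧ f x₀ = Sum.inl x) then 1 else A x y
    let B' : V → U → ℝ := fun x u => if x = x₀ ∧ f x₀ = Sum.inr u then 1 else B x u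
    have hrow : ∀ y ∈ X, y ≠ x₀ → Sum.elim (A' x₀) (B' x₀) (f y) = 0 := by
      intro y hy hne
      have hfy : f x₀ ≠ f y := fun e => hne (hf hx₀ hy e).symm
      rcases hb : f y with b | u
      · have h1 : b ≠ x₀ := fun e => hno y hy (e ▸ hb)
        rw [hb] at hfy
        simp only [Sum.elim_inl, A', hfy, h1, and_false, false_and, or_self, if_false]
        by_contra hne0
        rcases hA _ _ hne0 with h | h
        · simp at h
        · exact hno b (Finset.mem_of_mem_erase h.1) h.2
      · rw [hb] at hfy
        simp only [Sum.elim_inr, B', hfy, and_false, if_false]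
        by_contra hne0
        simpa using (hB _ _ hne0).1
    have hrow₀ : Sum.elim (A' x₀) (B' x₀) (f x₀) = 1 := by
      rcases hb : f x₀ with b | u
      · simp [A', hb]
      · simp [B', hb]
    have hother : ∀ x ∈ X.erase x₀, ∀ y ∈ X.erase x₀,
        Sum.elim (A' x) (B' x) (f y) = Sum.elim (A x) (B x) (f y) := by
      intro x hx y hy
      have hxne := Finset.ne_of_mem_erase hx
      rcases hb : f y with b | u
      · have h1 : b ≠ x₀ := fun e => hno y (Finset.mem_of_mem_erase hy) (e ▸ hb)
        simp [A', hxne, h1]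
      · simp [B', hxne]
    refine ⟨A', B', fun x y => ?_, fun x y hxy => ?_, fun x u hxu => ?_, fun w hw => ?_⟩
    · simp only [A', hsym x y, or_comm]
    · simp only [A'] at hxy
      split_ifs at hxy with h1
      · rcases h1 with ⟨rfl, h⟩ | ⟨rfl, h⟩
        · exact Or.inl ⟨hx₀, h⟩
        · exact Or.inr ⟨hx₀, h⟩
      · exact (hA x y hxy).imp (And.imp_left Finset.mem_of_mem_erase)
          (And.imp_left Finset.mem_of_mem_erase)
    · simp only [B'] at hxu
      split_ifs at hxu with h1
      · exact ⟨h1.1 ▸ hx₀, h1.1 ▸ h1.2⟩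
      · exact (hB x u hxu).imp_left Finset.mem_of_mem_erase
    · have hw₀ : w x₀ = 0 := by
        have := hw x₀ hx₀
        rwa [Finset.sum_eq_single_of_mem x₀ hx₀ fun y hy hne => by rw [hrow y hy hne, zero_mul],
          hrow₀, one_mul] at this
      intro x hx
      by_cases hxe : x = x₀
      · rw [hxe, hw₀]
      · refine hns w (fun z hz => ?_) x (Finset.mem_erase.2 ⟨hxe, hx⟩)
        rw [← hw z (Finset.mem_of_mem_erase hz), ← Finset.add_sum_erase X _ hx₀, hw₀, mul_zero,
          zero_add]
        exact Finset.sum_congr rfl fun y hy => by rw [hother z hz y hy]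

end Matching

/-! ### Rank, minors and term rank -/

section Rank

open Matrix

theorem rank_le_rank_of_vecMul_eq_zero {ι κ κ' : Type*} [Fintype ι] [Fintype κ] [Fintype κ']
    {M : Matrix ι κ ℝ} {N : Matrix ι κ' ℝ} (h : ∀ v, v ᵥ* N = 0 → v ᵥ* M = 0) :
    M.rank ≤ N.rank := by
  rw [← M.rank_transpose, ← N.rank_transpose]
  have h1 := LinearMap.finrank_range_add_finrank_ker Mᵀ.mulVecLin
  have h2 := LinearMap.finrank_range_add_finrank_ker Nᵀ.mulVecLin
  have h3 : LinearMap.ker Nᵀ.mulVecLin ≤ LinearMap.ker Mᵀ.mulVecLin := fun v hv => by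
    simp only [LinearMap.mem_ker, mulVecLin_apply, mulVec_transpose] at hv ⊢
    exact h v hv
  have h4 := Submodule.finrank_mono h3
  unfold Matrix.rank
  omega

theorem exists_submatrix_cols_linearIndependent {ι κ : Type*} [Fintype ι] [Fintype κ]
    (M : Matrix ι κ ℝ) {t : ℕ} (ht : t ≤ M.rank) :
    ∃ c : Fin t → κ, (M.submatrix id c).rank = t := by
  obtain ⟨κ', a, ha, hsp, hli⟩ := exists_linearIndependent' ℝ M.col
  have : Finite κ' := Finite.of_injective a ha
  have := Fintype.ofFinite κ'
  have hcard : t ≤ Fintype.card κ' := by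
    rw [← finrank_span_eq_card hli, hsp, ← rank_eq_finrank_span_cols]
    exact ht
  obtain ⟨e⟩ : Nonempty (Fin t ↪ κ') :=
    Function.Embedding.nonempty_of_card_le (by simpa using hcard)
  refine ⟨a ∘ e, ?_⟩
  have h1 : LinearIndependent ℝ (M.submatrix id (a ∘ e))ᵀ.row := hli.comp e e.injective
  rw [← rank_transpose, h1.rank_matrix, Fintype.card_fin]

theorem exists_submatrix_det_ne_zero {ι κ : Type*} [Fintype ι] [Fintype κ]
    (M : Matrix ι κ ℝ) {t : ℕ} (ht : t ≤ M.rank) :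
    ∃ (r : Fin t → ι) (c : Fin t → κ), (M.submatrix r c).det ≠ 0 := by
  obtain ⟨c, hc⟩ := exists_submatrix_cols_linearIndependent M ht
  obtain ⟨r, hr⟩ := exists_submatrix_cols_linearIndependent (M.submatrix id c)ᵀ
    (t := t) (by rw [rank_transpose, hc])
  refine ⟨r, c, fun h0 => ?_⟩
  obtain ⟨v, hv, hv0⟩ := exists_vecMul_eq_zero_iff.2 h0
  have h1 : ((M.submatrix id c)ᵀ.submatrix id r) = (M.submatrix r c)ᵀ := rfl
  rw [h1] at hr
  have h2 := LinearMap.finrank_range_add_finrank_ker ((M.submatrix r c)ᵀ).mulVecLin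
  unfold Matrix.rank at hr
  rw [hr, Module.finrank_pi, Fintype.card_fin, Nat.add_eq_left,
    Submodule.finrank_eq_zero] at h2
  have h3 : v ∈ LinearMap.ker ((M.submatrix r c)ᵀ).mulVecLin := by
    rw [LinearMap.mem_ker, mulVecLin_apply, mulVec_transpose, hv0]
  rw [h2] at h3
  exact hv h3

theorem le_rank_of_submatrix_det_ne_zero {ι κ : Type*} [Fintype ι] [Fintype κ]
    (M : Matrix ι κ ℝ) {t : ℕ} (r : Fin t → ι) (c : Fin t → κ)
    (h : (M.submatrix r c).det ≠ 0) : t ≤ M.rank := by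
  have h1 := rank_of_det_ne_zero h
  rw [Fintype.card_fin] at h1
  rw [← h1]
  exact rank_submatrix_le M r c

/-- A nonzero minor of maximal size has a nonzero term in its Leibniz expansion, whose factors lie
at distinct rows and columns. -/
theorem rank_le_termRank {ι κ : Type*} [Fintype ι] [Fintype κ] (S : StructMatrix ι κ)
    (M : Matrix ι κ ℝ) (h : ∀ i j, M i j ≠ 0 → S i j = Entry.star) : M.rank ≤ termRank S := by
  obtain ⟨r, c, hdet⟩ := exists_submatrix_det_ne_zero M le_rfl
  refine (termRank_isGreatest S).2 ?_
  have hdet' := hdet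
  rw [det_apply] at hdet'
  obtain ⟨σ, -, hσ⟩ := Finset.exists_ne_zero_of_sum_ne_zero hdet'
  have hne : ∀ l, M (r (σ l)) (c l) ≠ 0 := fun l h0 => hσ (by
    rw [Finset.prod_eq_zero (Finset.mem_univ l) (by simpa using h0), smul_zero])
  have hr : Function.Injective r := fun a b hab => by
    by_contra hne
    exact hdet (det_zero_of_row_eq hne (by ext j; simp [hab]))
  have hc : Function.Injective c := fun a b hab => by
    by_contra hne
    exact hdet (det_zero_of_column_eq hne (by intro j; simp [hab]))
  exact ⟨⟨r ∘ σ, hr.comp σ.injective⟩, ⟨c, hc⟩, fun l => h _ _ (hne l)⟩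

end Rank

/-! ### The controllable subspace of a symmetric system -/

section Controllability

open Matrix

variable {n m : ℕ}

/-- By Cayley–Hamilton, `A ^ k` is a combination of the powers below `n`. -/
theorem vecMul_pow_mul_eq_zero {A : Matrix (Fin n) (Fin n) ℝ} {B : Matrix (Fin n) (Fin m) ℝ}
    {v : Fin n → ℝ} (h : v ᵥ* ctrbMatrix A B = 0) (k : ℕ) : v ᵥ* (A ^ k * B) = 0 := by
  rcases Nat.eq_zero_or_pos n with rfl | hn
  · rw [Subsingleton.elim v 0, zero_vecMul]
  have hlt : ∀ k < n, v ᵥ* (A ^ k * B) = 0 := fun k hk =>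
    funext fun j => congrFun h (⟨k, hk⟩, j)
  have hdeg : (Polynomial.X ^ k %ₘ A.charpoly).natDegree < n := by
    have h1 := Polynomial.natDegree_modByMonic_lt (Polynomial.X ^ k) A.charpoly_monic (fun h1 => by
      have := A.charpoly_natDegree_eq_dim
      rw [h1, Polynomial.natDegree_one, Fintype.card_fin] at this
      omega)
    rwa [A.charpoly_natDegree_eq_dim, Fintype.card_fin] at h1
  rw [pow_eq_aeval_mod_charpoly, Polynomial.aeval_eq_sum_range' hdeg, Matrix.sum_mul,
    ← vecMulBilin_apply ℝ ℝ, map_sum]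
  refine Finset.sum_eq_zero fun i hi => ?_
  rw [vecMulBilin_apply, Matrix.smul_mul, vecMul_smul, hlt i (Finset.mem_range.1 hi), smul_zero]

theorem rank_ctrbMatrix_le (A : Matrix (Fin n) (Fin n) ℝ) (B : Matrix (Fin n) (Fin m) ℝ) :
    (ctrbMatrix A B).rank ≤ (fromCols A B).rank := by
  refine rank_le_rank_of_vecMul_eq_zero fun v hv => ?_
  rw [vecMul_fromCols] at hv
  have hA : v ᵥ* A = 0 := funext fun j => congrFun hv (Sum.inl j)
  have hB : v ᵥ* B = 0 := funext fun j => congrFun hv (Sum.inr j)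
  have key : ∀ k : ℕ, v ᵥ* (A ^ k * B) = 0 := by
    rintro (_ | k)
    · simpa using hB
    · rw [pow_succ', Matrix.mul_assoc, ← vecMul_vecMul, hA, zero_vecMul]
  exact funext fun ⟨k, j⟩ => congrFun (key k) j

/-- If all nonzero modes of a symmetric `A` are observable through `B`, the controllable subspace
contains the range of `A`. -/
theorem rank_fromCols_le_rank_ctrbMatrix {A : Matrix (Fin n) (Fin n) ℝ} (hA : A.IsSymm)
    {B : Matrix (Fin n) (Fin m) ℝ} {u : Fin m → ℝ}
    (h : NonzeroModesObservable Finset.univ A (B *ᵥ u)) :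
    (fromCols A B).rank ≤ (ctrbMatrix A B).rank := by
  let T := A.toEuclideanLin
  have hT : T.IsSymmetric := isSymmetric_toEuclideanLin_iff.2 (by rw [IsHermitian, conjTranspose_eq_transpose_of_trivial, hA.eq])
  -- Imposing the condition for all `k`, not only `k < n`, makes invariance under `A` immediate.
  let W : Submodule ℝ (EuclideanSpace ℝ (Fin n)) :=
    { carrier := {v | ∀ k : ℕ, v.ofLp ᵥ* (A ^ k * B) = 0}
      add_mem' := fun {v w} hv hw k => by
        rw [WithLp.ofLp_add, add_vecMul, hv k, hw k, add_zero]
      zero_mem' := fun k => by simp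
      smul_mem' := fun c v hv k => by rw [WithLp.ofLp_smul, smul_vecMul, hv k, smul_zero] }
  have hW : ∀ v ∈ W, T v ∈ W := fun v hv k => by
    have h1 : (T v).ofLp = v.ofLp ᵥ* A := by
      rw [← mulVec_transpose, hA.eq]; rfl
    rw [h1, vecMul_vecMul, ← Matrix.mul_assoc, ← pow_succ']
    exact hv (k + 1)
  have hTW := hT.restrict_invariant hW
  have hne : ∀ μ : ℝ, μ ≠ 0 → Module.End.eigenspace (T.restrict hW) μ = ⊥ := by
    intro μ hμ
    rw [eq_bot_iff]
    intro v hv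
    rw [Module.End.mem_eigenspace_iff] at hv
    have hv' : A *ᵥ (v : EuclideanSpace ℝ (Fin n)).ofLp =
        μ • (v : EuclideanSpace ℝ (Fin n)).ofLp :=
      congrArg (fun w : W => (w : EuclideanSpace ℝ (Fin n)).ofLp) hv
    have h0 := h μ hμ (v : EuclideanSpace ℝ (Fin n)).ofLp (by simp)
      (fun x _ => congrFun hv' x) (by
        change (B *ᵥ u) ⬝ᵥ _ = 0
        rw [dotProduct_comm, dotProduct_mulVec]
        have := v.2 0
        rw [pow_zero, Matrix.one_mul] at this
        rw [this, zero_dotProduct])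
    rw [Submodule.mem_bot]
    exact Subtype.ext (WithLp.ofLp_injective 2 h0)
  -- By the spectral theorem the eigenspaces span `W`; only the one at `0` survives, so `A` is zero
  -- on `W`.
  have htop : (⨆ μ, Module.End.eigenspace (T.restrict hW) μ) = ⊤ :=
    Submodule.orthogonal_eq_bot_iff.1 hTW.orthogonalComplement_iSup_eigenspaces_eq_bot
  have h0 : Module.End.eigenspace (T.restrict hW) 0 = ⊤ := by
    rw [eq_top_iff, ← htop]
    refine iSup_le fun μ => ?_
    by_cases hμ : μ = 0
    · rw [hμ]
    · rw [hne μ hμ]; exact bot_le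
  refine rank_le_rank_of_vecMul_eq_zero fun v hv => ?_
  have hvW : WithLp.toLp 2 v ∈ W := vecMul_pow_mul_eq_zero hv
  have hAv : v ᵥ* A = 0 := by
    have h1 : (⟨_, hvW⟩ : W) ∈ Module.End.eigenspace (T.restrict hW) 0 := by rw [h0]; trivial
    rw [Module.End.mem_eigenspace_iff, zero_smul] at h1
    rw [← mulVec_transpose, hA.eq]
    exact congrArg (fun w : W => (w : EuclideanSpace ℝ (Fin n)).ofLp) h1
  have hBv : v ᵥ* B = 0 := by simpa using hvW 0
  rw [vecMul_fromCols, hAv, hBv]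
  ext (j | j) <;> rfl

end Controllability

/-! ### Polynomial functions and proper varieties -/

section PolynomialFunctions

variable {σ : Type*}

/-- A real function on `ℝ^σ` given by a polynomial. -/
def IsPolynomialFun (f : (σ → ℝ) → ℝ) : Prop :=
  ∃ φ : MvPolynomial σ ℝ, ∀ x, MvPolynomial.eval x φ = f x

theorem IsPolynomialFun.const (a : ℝ) : IsPolynomialFun fun _ : σ → ℝ => a :=
  ⟨MvPolynomial.C a, fun _ => by simp⟩

theorem IsPolynomialFun.coord (i : σ) : IsPolynomialFun fun x : σ → ℝ => x i :=
  ⟨MvPolynomial.X i, fun _ => by simp⟩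

theorem IsPolynomialFun.mul {f g : (σ → ℝ) → ℝ} (hf : IsPolynomialFun f)
    (hg : IsPolynomialFun g) : IsPolynomialFun fun x => f x * g x := by
  obtain ⟨φ, hφ⟩ := hf
  obtain ⟨ψ, hψ⟩ := hg
  exact ⟨φ * ψ, fun x => by rw [map_mul, hφ, hψ]⟩

theorem IsPolynomialFun.sum {ι : Type*} (s : Finset ι) {f : ι → (σ → ℝ) → ℝ}
    (hf : ∀ i, IsPolynomialFun (f i)) : IsPolynomialFun fun x => ∑ i ∈ s, f i x := by
  choose φ hφ using hf
  exact ⟨∑ i ∈ s, φ i, fun x => by simp [hφ]⟩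

theorem IsPolynomialFun.prod {ι : Type*} (s : Finset ι) {f : ι → (σ → ℝ) → ℝ}
    (hf : ∀ i, IsPolynomialFun (f i)) : IsPolynomialFun fun x => ∏ i ∈ s, f i x := by
  choose φ hφ using hf
  exact ⟨∏ i ∈ s, φ i, fun x => by simp [hφ]⟩

theorem IsPolynomialFun.det {ι : Type*} [Fintype ι] [DecidableEq ι] {M : (σ → ℝ) → Matrix ι ι ℝ}
    (hM : ∀ i j, IsPolynomialFun fun x => M x i j) : IsPolynomialFun fun x => (M x).det := by
  simp only [Matrix.det_apply']
  exact IsPolynomialFun.sum _ fun τ => (IsPolynomialFun.const _).mul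
    (IsPolynomialFun.prod _ fun i => hM _ _)

theorem IsPolynomialFun.isProperVariety {f : (σ → ℝ) → ℝ} (hf : IsPolynomialFun f) {x : σ → ℝ}
    (hx : f x ≠ 0) : IsProperVariety {x | f x = 0} := by
  obtain ⟨φ, hφ⟩ := hf
  refine ⟨⟨{φ}, by ext y; simp [hφ]⟩, fun h => hx ?_⟩
  have : x ∈ {x | f x = 0} := h ▸ Set.mem_univ x
  exact this

/-- Two proper varieties do not cover the space. -/
theorem IsProperVariety.exists_notMem_notMem {V W : Set (σ → ℝ)} (hV : IsProperVariety V)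
    (hW : IsProperVariety W) : ∃ x, x ∉ V ∧ x ∉ W := by
  have key : ∀ {V : Set (σ → ℝ)}, IsProperVariety V →
      ∃ φ : MvPolynomial σ ℝ, φ ≠ 0 ∧ ∀ x ∈ V, MvPolynomial.eval x φ = 0 := by
    rintro V ⟨⟨S, rfl⟩, hne⟩
    obtain ⟨x, hx⟩ := (Set.ne_univ_iff_exists_notMem _).1 hne
    simp only [Set.mem_ofPred_eq, not_forall] at hx
    obtain ⟨φ, hφS, hφ⟩ := hx
    exact ⟨φ, fun h => hφ (by rw [h, map_zero]), fun y hy => hy φ hφS⟩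
  obtain ⟨φ, hφ, hφV⟩ := key hV
  obtain ⟨ψ, hψ, hψW⟩ := key hW
  have hne : ∃ x, MvPolynomial.eval x (φ * ψ) ≠ 0 := by
    by_contra! h
    exact mul_ne_zero hφ hψ (MvPolynomial.funext fun x => by rw [h x, map_zero])
  obtain ⟨x, hx⟩ := hne
  rw [map_mul] at hx
  exact ⟨x, fun h => left_ne_zero_of_mul hx (hφV x h), fun h => right_ne_zero_of_mul hx (hψW x h)⟩

end PolynomialFunctions

/-! ### Realizations and the generic dimension -/

section Realizations

open Matrix

variable {n m : ℕ}

theorem isPolynomialFun_ctrbMatrix {σ : Type*} {A : (σ → ℝ) → Matrix (Fin n) (Fin n) ℝ}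
    {B : (σ → ℝ) → Matrix (Fin n) (Fin m) ℝ} (hA : ∀ i j, IsPolynomialFun fun x => A x i j)
    (hB : ∀ i j, IsPolynomialFun fun x => B x i j) (i : Fin n) (kj : Fin n × Fin m) :
    IsPolynomialFun fun x => ctrbMatrix (A x) (B x) i kj := by
  have key : ∀ (k : ℕ) i j, IsPolynomialFun fun x => (A x ^ k * B x) i j := by
    intro k
    induction k with
    | zero => simpa using hB
    | succ k ih =>
      intro i j
      simp only [pow_succ', Matrix.mul_assoc, Matrix.mul_apply (M := A _)]
      exact IsPolynomialFun.sum _ fun l => (hA i l).mul (ih l j)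
  exact key _ _ _

theorem isPolynomialFun_symRealize {τ : Type*} (M : StructMatrix (Fin n) (Fin n))
    (g : SymParam M → τ) (i j : Fin n) :
    IsPolynomialFun fun p : τ → ℝ => symRealize M (p ∘ g) i j := by
  by_cases h : M i j = Entry.star
  · simpa [symRealize, h] using IsPolynomialFun.coord _
  · simpa [symRealize, h] using IsPolynomialFun.const 0

theorem isPolynomialFun_realize {τ : Type*} (M : StructMatrix (Fin n) (Fin m))
    (g : Param M → τ) (i : Fin n) (j : Fin m) :
    IsPolynomialFun fun p : τ → ℝ => realize M (p ∘ g) i j := by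
  by_cases h : M i j = Entry.star
  · simpa [realize, h] using IsPolynomialFun.coord _
  · simpa [realize, h] using IsPolynomialFun.const 0

theorem star_of_symRealize_ne_zero {M : StructMatrix (Fin n) (Fin n)} {p : SymParam M → ℝ}
    {i j : Fin n} (h : symRealize M p i j ≠ 0) : M i j = Entry.star := by
  by_contra hne
  exact h (by simp [symRealize, hne])

theorem star_of_realize_ne_zero {M : StructMatrix (Fin n) (Fin m)} {p : Param M → ℝ}
    {i : Fin n} {j : Fin m} (h : realize M p i j ≠ 0) : M i j = Entry.star := by
  by_contra hne
  exact h (by simp [realize, hne])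

theorem exists_symRealize_eq {M : StructMatrix (Fin n) (Fin n)} {A : Fin n → Fin n → ℝ}
    (hsym : ∀ x y, A x y = A y x) (hA : ∀ x y, A x y ≠ 0 → M x y = Entry.star) :
    ∃ p, symRealize M p = A := by
  refine ⟨fun e => Sym2.lift ⟨A, hsym⟩ e.1, ?_⟩
  ext x y
  by_cases h : M x y = Entry.star
  · simp [symRealize, h]
  · simpa [symRealize, h] using (not_not.1 (mt (hA x y) h)).symm

theorem exists_realize_eq {M : StructMatrix (Fin n) (Fin m)} {B : Fin n → Fin m → ℝ}
    (hB : ∀ x y, B x y ≠ 0 → M x y = Entry.star) : ∃ p, realize M p = B := by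
  refine ⟨fun e => B e.1.1 e.1.2, ?_⟩
  ext x y
  by_cases h : M x y = Entry.star
  · simp [realize, h]
  · simpa [realize, h] using (not_not.1 (mt (hB x y) h)).symm

theorem entry_eq_zero_of_ne_star {e : Entry} (h : e ≠ Entry.star) : e = 0 := by
  cases e
  · rfl
  · exact absurd rfl h

/-- In an irreducible pair every connected component of the state graph is reached by an input. -/
theorem IsIrreducible.isRooted {A : StructMatrix (Fin n) (Fin n)} (hA : A.IsSymm)
    {B : StructMatrix (Fin n) (Fin m)} (h : IsIrreducible A B) :
    IsRooted (fun x y => A x y = Entry.star) Finset.univ (fun x => ∃ j, B x j = Entry.star) := by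
  intro T _ hne hcl
  by_contra! hno
  have hcross : ∀ x ∈ T, ∀ y ∉ T, A x y = 0 := fun x hx y hy =>
    entry_eq_zero_of_ne_star fun h => hy (hcl x hx y (Finset.mem_univ y) h)
  -- A closed set `T` without inputs would be the second block of a reduction; its complement,
  -- possibly empty, is the first.
  let e : Fin (Fintype.card {x // x ∉ T}) ⊕ Fin (Fintype.card {x // x ∈ T}) ≃ Fin n :=
    (Equiv.sumCongr (Fintype.equivFin _).symm (Fintype.equivFin _).symm).trans
      ((Equiv.sumComm _ _).trans (Equiv.sumCompl (· ∈ T)))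
  have hel : ∀ a, e (Sum.inl a) ∉ T := fun a => ((Fintype.equivFin {x // x ∉ T}).symm a).2
  have her : ∀ a, e (Sum.inr a) ∈ T := fun a => ((Fintype.equivFin {x // x ∈ T}).symm a).2
  refine h ⟨_, _, ?_, e, (A.submatrix e e).toBlocks₁₁, (A.submatrix e e).toBlocks₂₂,
    (B.submatrix e id).toRows₁, ?_, ?_⟩
  · obtain ⟨x, hx⟩ := hne
    exact Fintype.card_pos_iff.2 ⟨⟨x, hx⟩⟩
  · ext (a | a) (b | b)
    · rfl
    · exact (hA.apply _ _).symm.trans (hcross _ (her b) _ (hel a))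
    · exact hcross _ (her a) _ (hel b)
    · rfl
  · ext (a | a) j
    · rfl
    · exact entry_eq_zero_of_ne_star (hno _ (her a) j)

/-- A symmetric realization attaining the term rank of `[A, B]`. -/
theorem exists_realization_submatrix_det_ne_zero {A : StructMatrix (Fin n) (Fin n)}
    (hA : A.IsSymm) (B : StructMatrix (Fin n) (Fin m)) :
    ∃ (A₁ : Fin n → Fin n → ℝ) (B₁ : Fin n → Fin m → ℝ)
      (r : Fin (termRank (fromCols A B)) → Fin n)
      (c : Fin (termRank (fromCols A B)) → Fin n ⊕ Fin m),
      (∀ x y, A₁ x y = A₁ y x) ∧ (∀ x y, A₁ x y ≠ 0 → A x y = Entry.star) ∧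
      (∀ x j, B₁ x j ≠ 0 → B x j = Entry.star) ∧
      ((fromCols (of A₁) (of B₁)).submatrix r c).det ≠ 0 := by
  obtain ⟨r, c, hrc⟩ := (termRank_isGreatest (fromCols A B)).1
  -- The default value `Sum.inl` is immaterial: only rows in the range of `r` are used.
  let f : Fin n → Fin n ⊕ Fin m := Function.extend r c Sum.inl
  have hf : ∀ l, f (r l) = c l := fun l => r.injective.extend_apply _ _ _
  have hinj : Set.InjOn f (Finset.univ.map r : Finset (Fin n)) := by
    intro x hx y hy hxy
    obtain ⟨a, -, rfl⟩ := Finset.mem_map.1 hx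
    obtain ⟨b, -, rfl⟩ := Finset.mem_map.1 hy
    rw [hf, hf] at hxy
    rw [c.injective hxy]
  obtain ⟨A₁, B₁, hsym, hA₁, hB₁, hns⟩ := exists_symmetric_nonsingular_of_matching _ f hinj
  have hstar : ∀ x ∈ (Finset.univ.map r : Finset (Fin n)), ∀ y, f x = y →
      fromCols A B x y = Entry.star := by
    rintro x hx _ rfl
    obtain ⟨a, -, rfl⟩ := Finset.mem_map.1 hx
    rw [hf]
    exact hrc a
  refine ⟨A₁, B₁, r, c, hsym, fun x y hxy => ?_, fun x j hxj => ?_, fun h0 => ?_⟩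
  · rcases hA₁ x y hxy with ⟨h1, h2⟩ | ⟨h1, h2⟩
    · exact hstar x h1 _ h2
    · exact (hA.apply x y).symm.trans (hstar y h1 _ h2)
  · obtain ⟨h1, h2⟩ := hB₁ x j hxj
    exact hstar x h1 _ h2
  · obtain ⟨w, hw, hw0⟩ := exists_mulVec_eq_zero_iff.2 h0
    apply hw
    have hw' : ∀ l, Function.extend r w 0 (r l) = w l := fun l => r.injective.extend_apply _ _ _
    ext l
    have := hns (Function.extend r w 0) ?_ (r l) (Finset.mem_map_of_mem _ (Finset.mem_univ l))
    · rwa [hw'] at this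
    · intro x hx
      obtain ⟨a, -, rfl⟩ := Finset.mem_map.1 hx
      rw [Finset.sum_map]
      simp only [hw', hf]
      rw [← Pi.zero_apply (M := fun _ => ℝ) a, ← hw0]
      refine Finset.sum_congr rfl fun b _ => ?_
      change _ = fromCols (of A₁) (of B₁) (r a) (c b) * w b
      rcases c b with y | j <;> rfl

/-- Some realization has a controllable subspace of dimension at least the term rank. -/
theorem IsIrreducible.exists_termRank_le_rank {A : StructMatrix (Fin n) (Fin n)}
    (hA : A.IsSymm) {B : StructMatrix (Fin n) (Fin m)} (h : IsIrreducible A B) :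
    ∃ p : SymParam A ⊕ Param B → ℝ, termRank (fromCols A B) ≤
      (ctrbMatrix (symRealize A (p ∘ Sum.inl)) (realize B (p ∘ Sum.inr))).rank := by
  obtain ⟨A₁, B₁, r, c, hsym, hA₁, hB₁, hdet⟩ := exists_realization_submatrix_det_ne_zero hA B
  have hcont : Continuous fun q : (Fin n → Fin n → ℝ) × (Fin n → Fin m → ℝ) =>
      ((fromCols (of q.1) (of q.2)).submatrix r c).det := by
    refine Continuous.matrix_det (continuous_matrix fun i j => ?_)
    rcases hj : c j with y | u
    · simp only [submatrix_apply, hj, fromCols_apply_inl, of_apply]; fun_prop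
    · simp only [submatrix_apply, hj, fromCols_apply_inr, of_apply]; fun_prop
  obtain ⟨ε, hε, hball⟩ := Metric.isOpen_iff.1 (isOpen_ne.preimage hcont) (A₁, B₁) hdet
  have hnear : ∀ (A₂ : Fin n → Fin n → ℝ) (B₂ : Fin n → Fin m → ℝ),
      (∀ x y, |A₂ x y - A₁ x y| < ε) → (∀ x y, |B₂ x y - B₁ x y| < ε) →
      ((fromCols (of A₂) (of B₂)).submatrix r c).det ≠ 0 := by
    intro A₂ B₂ h1 h2
    refine hball (a := (A₂, B₂)) ?_
    rw [Metric.mem_ball, Prod.dist_eq, max_lt_iff]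
    simp only [dist_pi_lt_iff hε, Real.dist_eq]
    exact ⟨h1, h2⟩
  obtain ⟨A₂, b, hsym₂, hA₂, hb, hnA, -, hQ⟩ :=
    (h.isRooted hA).exists_near_nonzeroModesObservable
      (fun x y hxy => (hA.apply x y).trans hxy) hsym hA₁ (b₀ := 0) (by simp) hε
  choose j hj using hb
  -- All inputs are driven by the all-ones vector. `B₀` puts `b x` at a single `⋆` of row `x`, so
  -- its row sums are `b`, and those of `B₁ + s B₀` are the row sums of `B₁` plus `s b`: observable
  -- for some small `s`.
  let B₀ : Fin n → Fin m → ℝ := fun x y => if h : b x = 0 then 0 else if y = j x h then b x else 0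
  have hB₀ : ∀ x, ∑ y, B₀ x y = b x := by
    intro x
    by_cases hx : b x = 0
    · simp [B₀, hx]
    · simp [B₀, hx]
  have hM : 0 < 1 + ∑ x, |b x| := by positivity
  obtain ⟨s, hs, hsQ⟩ := exists_abs_sub_lt_notMem
    (hQ.finite_not_add_smul fun x => ∑ y, B₁ x y) 0 (div_pos hε hM)
  let B₂ : Fin n → Fin m → ℝ := fun x y => B₁ x y + s * B₀ x y
  have hBstar : ∀ x y, B₂ x y ≠ 0 → B x y = Entry.star := by
    intro x y hxy
    by_cases h1 : B₁ x y = 0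
    · have h2 : B₀ x y ≠ 0 := fun h2 => hxy (by simp only [B₂, h1, h2, mul_zero, add_zero])
      simp only [B₀] at h2
      split_ifs at h2 with h3 h4
      · exact absurd rfl h2
      · rw [h4]; exact hj x h3
      · exact absurd rfl h2
    · exact hB₁ x y h1
  have hBn : ∀ x y, |B₂ x y - B₁ x y| < ε := by
    intro x y
    have h1 : |B₀ x y| ≤ |b x| := by
      simp only [B₀]; split_ifs <;> simp
    have h2 : |b x| ≤ ∑ x, |b x| :=
      Finset.single_le_sum (f := fun x => |b x|) (fun _ _ => abs_nonneg _) (Finset.mem_univ x)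
    rw [sub_zero] at hs
    simp only [B₂]
    rw [add_sub_cancel_left, abs_mul]
    calc |s| * |B₀ x y| ≤ |s| * (1 + ∑ x, |b x|) := by gcongr; linarith
      _ < ε / (1 + ∑ x, |b x|) * (1 + ∑ x, |b x|) := by gcongr
      _ = ε := div_mul_cancel₀ _ hM.ne'
  have hQ₂ : NonzeroModesObservable Finset.univ A₂ (of B₂ *ᵥ 1) :=
    (not_not.1 hsQ).congr (fun _ _ _ _ => rfl) fun x _ => by
      simp [mulVec, dotProduct, B₂, Finset.sum_add_distrib, ← Finset.mul_sum, hB₀]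
  obtain ⟨p, hp⟩ := exists_symRealize_eq hsym₂ hA₂
  obtain ⟨q, hq⟩ := exists_realize_eq hBstar
  refine ⟨Sum.elim p q, ?_⟩
  rw [Sum.elim_comp_inl, Sum.elim_comp_inr, hp, hq]
  exact (le_rank_of_submatrix_det_ne_zero _ r c (hnear A₂ B₂ hnA hBn)).trans
    (rank_fromCols_le_rank_ctrbMatrix (A := of A₂) (Matrix.ext fun x y => hsym₂ y x) hQ₂)

theorem rank_ctrbMatrix_realize_le (A : StructMatrix (Fin n) (Fin n))
    (B : StructMatrix (Fin n) (Fin m)) (p : SymParam A → ℝ) (q : Param B → ℝ) :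
    (ctrbMatrix (symRealize A p) (realize B q)).rank ≤ termRank (fromCols A B) := by
  refine (rank_ctrbMatrix_le _ _).trans (rank_le_termRank _ _ ?_)
  rintro i (j | j) h
  · exact star_of_symRealize_ne_zero h
  · exact star_of_realize_ne_zero h

/-- The variety is the zero set of one minor of the controllability matrix that is nonzero at the
realization found above. Off it the rank is at least the term rank; the opposite bound holds
everywhere. -/
theorem IsIrreducible.hasGenericControllableDim_termRank {A : StructMatrix (Fin n) (Fin n)}
    (hA : A.IsSymm) {B : StructMatrix (Fin n) (Fin m)} (h : IsIrreducible A B) :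
    HasGenericControllableDim A B (termRank (fromCols A B)) := by
  obtain ⟨p, hp⟩ := h.exists_termRank_le_rank hA
  obtain ⟨r, c, hdet⟩ := exists_submatrix_det_ne_zero _ hp
  have hpoly : IsPolynomialFun fun p : SymParam A ⊕ Param B → ℝ =>
      ((ctrbMatrix (symRealize A (p ∘ Sum.inl)) (realize B (p ∘ Sum.inr))).submatrix r c).det :=
    IsPolynomialFun.det fun i j => isPolynomialFun_ctrbMatrix
      (isPolynomialFun_symRealize A Sum.inl) (isPolynomialFun_realize B Sum.inr) (r i) (c j)
  exact ⟨_, hpoly.isProperVariety hdet, fun q hq =>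
    le_antisymm (rank_ctrbMatrix_realize_le A B _ _) (le_rank_of_submatrix_det_ne_zero _ r c hq)⟩

theorem HasGenericControllableDim.unique {A : StructMatrix (Fin n) (Fin n)}
    {B : StructMatrix (Fin n) (Fin m)} {k l : ℕ} (hk : HasGenericControllableDim A B k)
    (hl : HasGenericControllableDim A B l) : k = l := by
  obtain ⟨V, hV, hVk⟩ := hk
  obtain ⟨W, hW, hWl⟩ := hl
  obtain ⟨p, hpV, hpW⟩ := hV.exists_notMem_notMem hW
  rw [← hVk p hpV, hWl p hpW]

end Realizations


end StructuralControl

/-- The generic dimension of the controllable subspace exists, is unique, and equals the term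
rank of the concatenation `[A, B]`. -/
theorem lemma4 (n m : ℕ)
    (A : StructuralControl.StructMatrix (Fin n) (Fin n))
    (B : StructuralControl.StructMatrix (Fin n) (Fin m))
    (hA : A.IsSymm) (hAB : StructuralControl.IsIrreducible A B) :
    ∀ k : ℕ, StructuralControl.HasGenericControllableDim A B k ↔
      k = StructuralControl.termRank (Matrix.fromCols A B) := by
  intro k
  refine ⟨fun hk => hk.unique (hAB.hasGenericControllableDim_termRank hA), ?_⟩
  rintro rfl
  exact hAB.hasGenericControllableDim_termRank hA
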